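/- A lattice-ordered algebra is a real associative algebra $A$ (not assumed commutative or unital) that is also a vector lattice whose positive cone $A_+=\{a\in A: a\ge 0\}$ is closed under multiplication. It is an $f$-algebra if $a\wedge b=0$ implies $ac\wedge b=ca\wedge b=0$ for all $c\in A_+$, and it is semiprime if $0$ is its only nilpotent element. It is Archimedean if $\inf_{n\ge 1}\frac1n a=0$ for all $a\in A_+$, and Dedekind complete if every nonempty subset that is bounded above has a supremum. Let $A$ be an Archimedean semiprime $f$-algebra. An element $a\in A$ is called bounded if $a^2\in A(a)$, where $A(a)=\{x\in A: |x|\le\mu|a|\text{ for some }\mu\in(0,\infty)\}$ is the principal order ideal generated by $a$; the set of bounded elements is denoted by $A_b$. An intermediate algebra in $A$ is a subalgebra $B$ of $A$ (not required to be unital) with $A_b\subseteq B$. Theorem. If $A$ is a Dedekind complete Archimedean semiprime $f$-algebra, then every intermediate algebra $B$ in $A$ is an order ideal of $A$, that is, if $a\in A$, $b\in B$ and $|a|\le|b|$, then $a\in B$. In particular, $B$ is closed under the lattice operations of $A$ and, with the operations and order inherited from $A$, is a Dedekind complete semiprime $f$-algebra. -/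

import Mathlib

namespace SemiprimeFAlgebra

/-- The real vector space `A`, with its lattice order, is a vector lattice (Riesz space). -/
class IsVectorLattice (A : Type*) [AddCommGroup A] [Module ℝ A] [Lattice A] : Prop
    extends IsOrderedAddMonoid A, IsOrderedModule ℝ A

/-- The (associative, not necessarily commutative or unital) real algebra `A`, with its lattice
order, is a lattice-ordered algebra: a vector lattice whose positive cone is closed under
multiplication. -/
class IsLatticeOrderedAlgebra (A : Type*) [NonUnitalRing A] [Module ℝ A] [IsScalarTower ℝ A A]
    [SMulCommClass ℝ A A] [Lattice A] : Prop extends IsVectorLattice A where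
  mul_nonneg' : ∀ a b : A, 0 ≤ a → 0 ≤ b → 0 ≤ a * b

/-- `A` is an `f`-algebra: a lattice-ordered algebra in which multiplication by positive
elements, on either side, preserves disjointness from a given element. -/
class IsFAlgebra (A : Type*) [NonUnitalRing A] [Module ℝ A] [IsScalarTower ℝ A A]
    [SMulCommClass ℝ A A] [Lattice A] : Prop extends IsLatticeOrderedAlgebra A where
  mul_inf_eq_zero : ∀ a b c : A, a ⊓ b = 0 → 0 ≤ c → (a * c) ⊓ b = 0 ∧ (c * a) ⊓ b = 0

/-- The positive power `a ^ (n + 1)` in a possibly non-unital algebra. -/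
def powSucc {A : Type*} [Mul A] (a : A) : ℕ → A
  | 0 => a
  | n + 1 => powSucc a n * a

/-- `A` is semiprime: `0` is the only nilpotent element. -/
def IsSemiprime (A : Type*) [NonUnitalRing A] : Prop :=
  ∀ a : A, (∃ n : ℕ, powSucc a n = 0) → a = 0

/-- The vector lattice `A` is Archimedean: for every `a ≥ 0`, the infimum of the elements
`(1 / n) a`, `n = 1, 2, …`, is `0`. (Mathlib's `Archimedean` is the notion for linear orders.) -/
def IsArchimedean (A : Type*) [AddCommGroup A] [Module ℝ A] [Lattice A] : Prop :=
  ∀ a : A, 0 ≤ a → IsGLB (Set.range fun n : ℕ => (1 / ((n : ℝ) + 1)) • a) 0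

/-- Every nonempty subset which is bounded above has a supremum. -/
def IsDedekindComplete (A : Type*) [Lattice A] : Prop :=
  ∀ s : Set A, s.Nonempty → BddAbove s → ∃ x, IsLUB s x

/-- The principal order ideal `A(a)` generated by `a`. -/
def principalOrderIdeal {A : Type*} [AddCommGroup A] [Module ℝ A] [Lattice A] (a : A) : Set A :=
  {x | ∃ μ : ℝ, 0 < μ ∧ |x| ≤ μ • |a|}

/-- The set `A_b` of bounded elements: those `a` with `a²` in the principal order ideal of `a`. -/
def boundedElements (A : Type*) [NonUnitalRing A] [Module ℝ A] [Lattice A] : Set A :=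
  {a | a * a ∈ principalOrderIdeal a}

/-- An intermediate algebra in `A`: a subalgebra containing all bounded elements. -/
def IsIntermediate {A : Type*} [NonUnitalRing A] [Module ℝ A] [Lattice A]
    (B : NonUnitalSubalgebra ℝ A) : Prop :=
  boundedElements A ⊆ (B : Set A)

/-- The vector subspace `V` is an order ideal, i.e. it is solid: `b ∈ V` and
`|a| ≤ |b|` imply `a ∈ V`. -/
def IsOrderIdeal {A : Type*} [AddCommGroup A] [Module ℝ A] [Lattice A]
    (V : Submodule ℝ A) : Prop :=
  LatticeOrderedAddCommGroup.IsSolid (V : Set A)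

end SemiprimeFAlgebra

namespace SemiprimeFAlgebra

section VectorLattice

variable {A : Type*} [AddCommGroup A] [Lattice A] [IsOrderedAddMonoid A]

/-! For `0 ≤ a ≤ |b|` with `b ∈ B`, solve `u + u * b² = a`, so that formally `u = a / (1 + b²)`
(`exists_add_mul_eq`). Then `u`, `u * |b|` and `u * |b|²` are all at most `|b|`, so `u` and `u *
|b|` are at most `1` on the support of `b`; by semiprimeness (`mul_self_le_of_mul_le`) `u` and `u *
b` are bounded. Hence both lie in `B`, and so does `a = u + (u * b) * b`. Differences of positive
parts give solidity, from which the rest follows. -/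

theorem le_of_le_add_of_inf_eq_zero {x r z : A} (hr : 0 ≤ r) (h : x ≤ r + z)
    (hxz : x ⊓ z = 0) : x ≤ r := by
  have h1 : x ≤ (r + x) ⊓ (r + z) := le_inf (le_add_of_nonneg_left hr) h
  rwa [← add_inf, hxz, add_zero] at h1

theorem abs_sub_of_inf_eq_zero {x y : A} (h : x ⊓ y = 0) : |x - y| = x + y := by
  have h1 := sup_sub_inf_eq_abs_sub y x
  have h2 := inf_add_sup x y
  rw [h, zero_add] at h2
  rw [sup_comm, inf_comm] at h1
  rw [h, sub_zero, h2] at h1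
  exact h1.symm

end VectorLattice

section Archimedean

variable {A : Type*} [AddCommGroup A] [Module ℝ A] [Lattice A]

theorem IsArchimedean.nonpos_of_forall_le (hArch : IsArchimedean A) {x y : A} (hy : 0 ≤ y)
    (h : ∀ n : ℕ, x ≤ (1 / ((n : ℝ) + 1)) • y) : x ≤ 0 :=
  (hArch y hy).2 (by rintro _ ⟨n, rfl⟩; exact h n)

end Archimedean

section FAlgebra

variable {A : Type*} [NonUnitalRing A] [Module ℝ A] [IsScalarTower ℝ A A]
    [SMulCommClass ℝ A A] [Lattice A] [IsFAlgebra A]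

theorem mul_nonneg_of_nonneg {a b : A} (ha : 0 ≤ a) (hb : 0 ≤ b) : 0 ≤ a * b :=
  IsLatticeOrderedAlgebra.mul_nonneg' a b ha hb

theorem mul_le_mul_of_le_left {a b c : A} (h : a ≤ b) (hc : 0 ≤ c) : c * a ≤ c * b := by
  have := mul_nonneg_of_nonneg hc (sub_nonneg.2 h)
  rwa [mul_sub, sub_nonneg] at this

theorem mul_le_mul_of_le_right {a b c : A} (h : a ≤ b) (hc : 0 ≤ c) : a * c ≤ b * c := by
  have := mul_nonneg_of_nonneg (sub_nonneg.2 h) hc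
  rwa [sub_mul, sub_nonneg] at this

theorem mul_right_inf_eq_zero {a b c : A} (h : a ⊓ b = 0) (hc : 0 ≤ c) : (a * c) ⊓ b = 0 :=
  (IsFAlgebra.mul_inf_eq_zero a b c h hc).1

theorem mul_left_inf_eq_zero {a b c : A} (h : a ⊓ b = 0) (hc : 0 ≤ c) : (c * a) ⊓ b = 0 :=
  (IsFAlgebra.mul_inf_eq_zero a b c h hc).2

/-- Multiplying each factor in turn makes `a * b` disjoint from itself. -/
theorem mul_eq_zero_of_inf_eq_zero {a b : A} (h : a ⊓ b = 0) : a * b = 0 := by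
  have ha : 0 ≤ a := h ▸ inf_le_left
  have hb : 0 ≤ b := h ▸ inf_le_right
  have h1 : b ⊓ (a * b) = 0 := by rw [inf_comm]; exact mul_right_inf_eq_zero h hb
  have h2 := mul_left_inf_eq_zero h1 ha
  rwa [inf_idem] at h2

theorem abs_mul_abs_self_eq (b : A) : |b| * |b| = b * b := by
  have h1 := mul_eq_zero_of_inf_eq_zero (posPart_inf_negPart_eq_zero b)
  have h2 := mul_eq_zero_of_inf_eq_zero ((inf_comm _ _).trans (posPart_inf_negPart_eq_zero b))
  rw [← posPart_add_negPart b]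
  conv_rhs => rw [← posPart_sub_negPart b]
  simp only [mul_add, add_mul, mul_sub, sub_mul, h1, h2]
  abel

theorem mul_self_nonneg_of_fAlgebra (b : A) : 0 ≤ b * b := by
  rw [← abs_mul_abs_self_eq]
  exact mul_nonneg_of_nonneg (abs_nonneg b) (abs_nonneg b)

theorem abs_mul_of_nonneg_left {u : A} (hu : 0 ≤ u) (b : A) : |u * b| = u * |b| := by
  have h1 := mul_left_inf_eq_zero (posPart_inf_negPart_eq_zero b) hu
  have h2 := mul_left_inf_eq_zero ((inf_comm _ _).trans h1) hu
  conv_lhs => rw [← posPart_sub_negPart b]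
  rw [mul_sub, abs_sub_of_inf_eq_zero ((inf_comm _ _).trans h2), ← mul_add,
    posPart_add_negPart]

/-! ### Division by `1 + d` -/

/-- A substitute for the inequality of arithmetic and geometric means, `t ≤ 1 + t²`. -/
theorem mul_le_add_mul_mul {u t : A} (hu : 0 ≤ u) (ht : 0 ≤ t) : u * t ≤ u + u * t * t := by
  set z := u * t - u with hz
  have hd := posPart_inf_negPart_eq_zero z
  have hd' : z⁺ ⊓ (z⁻ * t) = 0 := by
    rw [inf_comm]
    exact mul_right_inf_eq_zero ((inf_comm _ _).trans hd) ht
  have hut := mul_nonneg_of_nonneg hu ht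
  have hx : z⁺ ≤ u * t := by
    rw [posPart_def]
    exact sup_le (sub_le_self _ hu) hut
  have hzt : u * t * t - u * t = z⁺ * t - z⁻ * t := by
    rw [← sub_mul, ← sub_mul, posPart_sub_negPart]
  -- The term `z⁻ * t` is disjoint from `z⁺`, so it can then be dropped.
  have h1 : z⁺ ≤ u * t * t + z⁻ * t := by
    refine hx.trans ?_
    have h2 : u * t * t + z⁻ * t = u * t + z⁺ * t := by
      rw [sub_eq_sub_iff_add_eq_add] at hzt
      rw [hzt, add_comm]
    rw [h2]
    exact le_add_of_nonneg_right (mul_nonneg_of_nonneg (posPart_nonneg z) ht)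
  have h3 := le_of_le_add_of_inf_eq_zero (mul_nonneg_of_nonneg hut ht) h1 hd'
  have h4 : u * t = u + z := by rw [hz]; abel
  calc u * t = u + z := h4
    _ ≤ u + z⁺ := by gcongr; exact le_posPart z
    _ ≤ u + u * t * t := by gcongr

theorem mul_le_smul_add_smul_mul_mul {u t : A} (hu : 0 ≤ u) (ht : 0 ≤ t) {c : ℝ} (hc : 0 < c) :
    u * t ≤ c • u + (1 / c) • (u * t * t) := by
  have h := mul_le_add_mul_mul hu (smul_nonneg (one_div_pos.2 hc).le ht)
  have h' := smul_le_smul_of_nonneg_left h hc.le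
  simp only [mul_smul_comm, smul_mul_assoc, smul_add, smul_smul] at h'
  rwa [mul_one_div_cancel hc.ne', one_smul, ← mul_assoc, mul_one_div_cancel hc.ne',
    one_mul] at h'

/-- Formally the positive part of `r(1 - d)` lives where `d ≤ 1`. It cuts `r` down to a piece on
which multiplication by `d` is controlled. -/
theorem mul_posPart_sub_le {r d : A} (hr : 0 ≤ r) (hd : 0 ≤ d) :
    (r - r * d)⁺ ≤ r ∧ (r - r * d)⁺ * d ≤ r := by
  set z := r - r * d with hz
  have hx : z⁺ ≤ r := by
    rw [posPart_def]
    exact sup_le (sub_le_self _ (mul_nonneg_of_nonneg hr hd)) hr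
  refine ⟨hx, le_of_le_add_of_inf_eq_zero hr ?_
    (mul_right_inf_eq_zero (posPart_inf_negPart_eq_zero z) hd)⟩
  refine (mul_le_mul_of_le_right hx hd).trans ?_
  have h1 : r + z⁻ = r * d + z⁺ := by
    have h2 := posPart_sub_negPart z
    rw [sub_eq_iff_eq_add] at h2
    rw [h2, hz]; abel
  rw [h1]
  exact le_add_of_nonneg_right (posPart_nonneg z)

/-- In a Dedekind complete `f`-algebra, `1 + d` divides every positive element when `0 ≤ d`. -/
theorem exists_add_mul_eq (hArch : IsArchimedean A) (hDed : IsDedekindComplete A) {a d : A}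
    (ha : 0 ≤ a) (hd : 0 ≤ d) : ∃ u : A, 0 ≤ u ∧ u + u * d = a := by
  obtain ⟨u, hu⟩ := hDed {w : A | 0 ≤ w ∧ w + w * d ≤ a} ⟨0, le_rfl, by simpa using ha⟩
    ⟨a, fun w hw => (le_add_of_nonneg_right (mul_nonneg_of_nonneg hw.1 hd)).trans hw.2⟩
  have hu0 : 0 ≤ u := hu.1 ⟨le_rfl, by simpa using ha⟩
  have hudd := mul_nonneg_of_nonneg (mul_nonneg_of_nonneg hu0 hd) hd
  have hle : u + u * d ≤ a := by
    rw [← sub_nonpos]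
    refine hArch.nonpos_of_forall_le hudd fun n => ?_
    have hc : (0 : ℝ) < (n : ℝ) + 1 := by positivity
    generalize (n : ℝ) + 1 = c at hc ⊢
    have hc1 : (0 : ℝ) < 1 + c := by positivity
    set y := u + u * d - a - (1 / c) • (u * d * d) with hy
    -- If `y` had a positive part, this would improve the supremum. The error term `(1 / c) • (u * d
    -- * d)` vanishes as `c` grows.
    have key : u ≤ u - (1 / (1 + c)) • y := by
      refine hu.2 fun w hw => ?_
      have huw : 0 ≤ u - w := sub_nonneg.2 (hu.1 hw)
      have h1 := mul_le_smul_add_smul_mul_mul huw hd hc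
      have h2 : (u - w) * d * d ≤ u * d * d :=
        mul_le_mul_of_le_right (mul_le_mul_of_le_right (sub_le_self _ hw.1) hd) hd
      have h3 : (u - w) * d ≤ c • (u - w) + (1 / c) • (u * d * d) :=
        h1.trans (add_le_add le_rfl (smul_le_smul_of_nonneg_left h2 (one_div_pos.2 hc).le))
      have h4 : y ≤ (1 + c) • (u - w) := by
        rw [sub_mul, ← sub_nonneg] at h3
        have h5 := add_nonneg h3 (sub_nonneg.2 hw.2)
        rw [← sub_nonneg]
        refine h5.trans_eq ?_
        rw [hy, add_smul, one_smul]
        abel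
      have h6 := smul_le_smul_of_nonneg_left h4 (one_div_pos.2 hc1).le
      rw [smul_smul, one_div_mul_cancel hc1.ne', one_smul] at h6
      exact le_sub_comm.1 h6
    have h7 : (1 / (1 + c)) • y ≤ 0 := by
      rw [le_sub_self_iff] at key
      exact key
    have h8 := smul_le_smul_of_nonneg_left h7 hc1.le
    rw [smul_smul, mul_one_div_cancel hc1.ne', one_smul, smul_zero, hy, sub_nonpos] at h8
    exact h8
  refine ⟨u, hu0, le_antisymm hle ?_⟩
  have hr : 0 ≤ a - (u + u * d) := sub_nonneg.2 hle
  set r := a - (u + u * d) with hrdef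
  rw [← sub_nonpos, ← hrdef]
  refine hArch.nonpos_of_forall_le (mul_nonneg_of_nonneg hr hd) fun n => ?_
  have hc : (0 : ℝ) < (n : ℝ) + 1 := by positivity
  generalize (n : ℝ) + 1 = c at hc ⊢
  have hc1 : (0 : ℝ) < 1 + c := by positivity
  obtain ⟨hx1, hx2⟩ := mul_posPart_sub_le hr (smul_nonneg (one_div_pos.2 hc).le hd)
  rw [mul_smul_comm] at hx1 hx2
  have hx0 := posPart_nonneg (r - (1 / c) • (r * d))
  have hle' := le_posPart (r - (1 / c) • (r * d))
  set x := (r - (1 / c) • (r * d))⁺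
  have hxd : x * d ≤ c • r := by
    have h := smul_le_smul_of_nonneg_left hx2 hc.le
    rwa [mul_smul_comm, smul_smul, mul_one_div_cancel hc.ne', one_smul] at h
  have hxs : (1 / (1 + c)) • (x + x * d) ≤ r := by
    have h := smul_le_smul_of_nonneg_left (add_le_add hx1 hxd) (one_div_pos.2 hc1).le
    have h9 : r + c • r = (1 + c) • r := by rw [add_smul, one_smul]
    rwa [h9, smul_smul, one_div_mul_cancel hc1.ne', one_smul] at h
  -- The truncated remainder `x`, scaled down, could be added to `u` within the defining set, so
  -- maximality forces `x ≤ 0`, that is `r ≤ (1 / c) • (r * d)`.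
  have hmem : u + (1 / (1 + c)) • x ≤ u := by
    refine hu.1 ⟨add_nonneg hu0 (smul_nonneg (one_div_pos.2 hc1).le hx0), ?_⟩
    rw [hrdef, ← sub_nonneg] at hxs
    rw [← sub_nonneg]
    refine hxs.trans_eq ?_
    rw [add_mul, smul_mul_assoc, smul_add]
    abel
  have hx : x ≤ 0 := by
    have h := smul_le_smul_of_nonneg_left ((add_le_iff_nonpos_right u).1 hmem) hc1.le
    rwa [smul_smul, mul_one_div_cancel hc1.ne', one_smul, smul_zero] at h
  exact sub_nonpos.1 (hle'.trans hx)

/-! ### Bounded elements and solidity -/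

/-- An element `v` of the order interval `[0, t]` that is at most `1` on the support of `t`
satisfies `v² ≤ v`. -/
theorem mul_self_le_of_mul_le (hSemi : IsSemiprime A) {v t : A} (hv : 0 ≤ v) (hvt : v ≤ t)
    (h : v * t ≤ t) : v * v ≤ v := by
  have ht := hv.trans hvt
  set z := v * v - v with hz
  have hvv := mul_nonneg_of_nonneg hv hv
  have hx : z⁺ ≤ v * v := by
    rw [posPart_def]
    exact sup_le (sub_le_self _ hv) hvv
  have hx0 := posPart_nonneg z
  -- The two sides are disjoint, so the smaller one is zero.
  have hzt : z⁺ * t ≤ z⁻ * t := by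
    rw [← sub_nonpos, ← sub_mul, posPart_sub_negPart, hz, sub_mul, sub_nonpos, mul_assoc]
    exact mul_le_mul_of_le_left h hv
  have hd1 := mul_right_inf_eq_zero (posPart_inf_negPart_eq_zero z) ht
  have hd2 := mul_right_inf_eq_zero ((inf_comm _ _).trans hd1) ht
  have hxt : z⁺ * t = 0 := by rwa [inf_eq_right.2 hzt] at hd2
  have hm0 : 0 ≤ z⁺ ⊓ t := le_inf hx0 ht
  have hm : z⁺ ⊓ t = 0 := by
    -- Index `1` of `powSucc` is the square.
    refine hSemi _ ⟨1, le_antisymm ?_ (mul_nonneg_of_nonneg hm0 hm0)⟩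
    exact ((mul_le_mul_of_le_right inf_le_left hm0).trans
      (mul_le_mul_of_le_left inf_le_right hx0)).trans_eq hxt
  have hvx : v ⊓ z⁺ = 0 :=
    le_antisymm ((le_inf inf_le_right (inf_le_left.trans hvt)).trans_eq hm) (le_inf hv hx0)
  -- Now `v * v` is disjoint from `z⁺`, yet dominates it.
  have h1 := mul_right_inf_eq_zero hvx hv
  rw [inf_eq_right.2 hx] at h1
  exact sub_nonpos.1 ((le_posPart z).trans_eq h1)

theorem mem_boundedElements_of_abs_mul_abs_le {v : A} (h : |v| * |v| ≤ |v|) :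
    v ∈ boundedElements A := by
  refine ⟨1, one_pos, ?_⟩
  rwa [one_smul, abs_of_nonneg (mul_self_nonneg_of_fAlgebra v), ← abs_mul_abs_self_eq]

theorem IsIntermediate.mem_of_nonneg_of_le_abs (hArch : IsArchimedean A) (hSemi : IsSemiprime A)
    (hDed : IsDedekindComplete A) {B : NonUnitalSubalgebra ℝ A} (hB : IsIntermediate B) {a b : A}
    (hb : b ∈ B) (ha : 0 ≤ a) (hab : a ≤ |b|) : a ∈ B := by
  obtain ⟨u, hu, hua⟩ := exists_add_mul_eq hArch hDed ha (mul_self_nonneg_of_fAlgebra b)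
  have ht := abs_nonneg b
  have hut := mul_nonneg_of_nonneg hu ht
  have hutt := mul_nonneg_of_nonneg hut ht
  have hua' : u + u * |b| * |b| = a := by rw [mul_assoc, abs_mul_abs_self_eq, hua]
  have hut_le : u * |b| ≤ |b| := ((mul_le_add_mul_mul hu ht).trans_eq hua').trans hab
  have hu_le : u ≤ |b| := (le_add_of_nonneg_right hutt).trans (hua'.trans_le hab)
  have hutt_le : u * |b| * |b| ≤ |b| := (le_add_of_nonneg_left hu).trans (hua'.trans_le hab)
  have huB : u ∈ B := hB <| mem_boundedElements_of_abs_mul_abs_le <| by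
    rw [abs_of_nonneg hu]
    exact mul_self_le_of_mul_le hSemi hu hu_le hut_le
  -- The factor is `u * b`, not `u * |b|`: membership of `|b|` in `B` is not yet known.
  have hubB : u * b ∈ B := hB <| mem_boundedElements_of_abs_mul_abs_le <| by
    rw [abs_mul_of_nonneg_left hu]
    exact mul_self_le_of_mul_le hSemi hut hut_le hutt_le
  rw [← hua, ← mul_assoc]
  exact add_mem huB (mul_mem hubB hb)

theorem IsIntermediate.isOrderIdeal (hArch : IsArchimedean A) (hSemi : IsSemiprime A)
    (hDed : IsDedekindComplete A) {B : NonUnitalSubalgebra ℝ A} (hB : IsIntermediate B) :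
    IsOrderIdeal B.toSubmodule := by
  intro b hb a hab
  have h1 : a⁺ ≤ |b| := (sup_le (le_abs_self a) (abs_nonneg a)).trans hab
  have h2 : a⁻ ≤ |b| := (sup_le (neg_le_abs a) (abs_nonneg a)).trans hab
  have h := sub_mem (hB.mem_of_nonneg_of_le_abs hArch hSemi hDed hb (posPart_nonneg a) h1)
    (hB.mem_of_nonneg_of_le_abs hArch hSemi hDed hb (negPart_nonneg a) h2)
  rwa [posPart_sub_negPart] at h

/-! ### Structure inherited by `B` -/

theorem sup_mem_of_isOrderIdeal {B : NonUnitalSubalgebra ℝ A} (h : IsOrderIdeal B.toSubmodule)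
    {x y : A} (hx : x ∈ B) (hy : y ∈ B) : x ⊔ y ∈ B := by
  have hle : |(x - y)⁺| ≤ |x - y| := by
    rw [abs_of_nonneg (posPart_nonneg _)]
    exact sup_le (le_abs_self _) (abs_nonneg _)
  have hp : (x - y)⁺ ∈ B := h (sub_mem hx hy) hle
  have h1 : x ⊔ y = (x - y)⁺ + y := by
    rw [posPart_def, sup_add, sub_add_cancel, zero_add]
  rw [h1]
  exact add_mem hp hy

theorem inf_mem_of_isOrderIdeal {B : NonUnitalSubalgebra ℝ A} (h : IsOrderIdeal B.toSubmodule)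
    {x y : A} (hx : x ∈ B) (hy : y ∈ B) : x ⊓ y ∈ B := by
  have h1 : x ⊓ y = x + y - (x ⊔ y) := eq_sub_of_add_eq (inf_add_sup x y)
  rw [h1]
  exact sub_mem (add_mem hx hy) (sup_mem_of_isOrderIdeal h hx hy)

theorem isFAlgebra_subtype (B : NonUnitalSubalgebra ℝ A)
    (hsup : ∀ ⦃x y : A⦄, x ∈ B → y ∈ B → x ⊔ y ∈ B)
    (hinf : ∀ ⦃x y : A⦄, x ∈ B → y ∈ B → x ⊓ y ∈ B) :
    letI : Lattice B := Subtype.lattice hsup hinf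
    IsFAlgebra B := by
  let : Lattice B := Subtype.lattice hsup hinf
  exact
    { add_le_add_left := fun a b h c => add_le_add_left (α := A) h c
      smul_le_smul_of_nonneg_left := fun c hc a b h =>
        smul_le_smul_of_nonneg_left (β := A) h hc
      smul_le_smul_of_nonneg_right := fun a ha c d h =>
        smul_le_smul_of_nonneg_right (β := A) h ha
      mul_nonneg' := fun a b ha hb => mul_nonneg_of_nonneg (A := A) ha hb
      mul_inf_eq_zero := fun a b c h hc => by
        have h' : (a : A) ⊓ b = 0 := congrArg Subtype.val h
        exact ⟨Subtype.ext (mul_right_inf_eq_zero (A := A) (c := c) h' hc),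
          Subtype.ext (mul_left_inf_eq_zero (A := A) (c := c) h' hc)⟩ }

theorem isDedekindComplete_subtype (hDed : IsDedekindComplete A) {B : NonUnitalSubalgebra ℝ A}
    (h : IsOrderIdeal B.toSubmodule)
    (hsup : ∀ ⦃x y : A⦄, x ∈ B → y ∈ B → x ⊔ y ∈ B)
    (hinf : ∀ ⦃x y : A⦄, x ∈ B → y ∈ B → x ⊓ y ∈ B) :
    letI : Lattice B := Subtype.lattice hsup hinf
    IsDedekindComplete B := by
  let : Lattice B := Subtype.lattice hsup hinf
  rintro s ⟨b, hb⟩ ⟨c, hc⟩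
  have hcA : (c : A) ∈ upperBounds (Subtype.val '' s) := by
    rintro _ ⟨w, hw, rfl⟩
    exact hc hw
  obtain ⟨x, hx⟩ := hDed (Subtype.val '' s) ⟨b, b, hb, rfl⟩ ⟨c, hcA⟩
  have hbx : (b : A) ≤ x := hx.1 ⟨b, hb, rfl⟩
  have hxc : x ≤ c := hx.2 hcA
  -- Translating by `b ∈ s` makes both sides positive, so solidity applies to the supremum whatever
  -- its sign.
  have hle : |x - b| ≤ |(c : A) - b| := by
    rw [abs_of_nonneg (sub_nonneg.2 hbx), abs_of_nonneg (sub_nonneg.2 (hbx.trans hxc))]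
    exact sub_le_sub_right hxc _
  have hxb : x - b ∈ B := h (sub_mem c.2 b.2) hle
  have hxB : x ∈ B := by simpa using add_mem hxb b.2
  refine ⟨⟨x, hxB⟩, fun w hw => hx.1 ⟨w, hw, rfl⟩, fun w hw => hx.2 ?_⟩
  rintro _ ⟨y, hy, rfl⟩
  exact hw hy

end FAlgebra

theorem IsSemiprime.subtype {A : Type*} [NonUnitalRing A] [Module ℝ A] (hSemi : IsSemiprime A)
    (B : NonUnitalSubalgebra ℝ A) : IsSemiprime B := by
  rintro a ⟨n, hn⟩
  have h : ∀ m : ℕ, ((powSucc a m : B) : A) = powSucc (a : A) m := by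
    intro m
    induction m with
    | zero => rfl
    | succ m ih => simp [powSucc, ih]
  exact Subtype.ext (hSemi a ⟨n, by rw [← h, hn]; rfl⟩)

end SemiprimeFAlgebra

theorem mainTheorem5 {A : Type*} [NonUnitalRing A] [Module ℝ A] [IsScalarTower ℝ A A]
    [SMulCommClass ℝ A A] [Lattice A] [SemiprimeFAlgebra.IsFAlgebra A]
    (hArch : SemiprimeFAlgebra.IsArchimedean A)
    (hSemi : SemiprimeFAlgebra.IsSemiprime A)
    (hDed : SemiprimeFAlgebra.IsDedekindComplete A)
    (B : NonUnitalSubalgebra ℝ A) (hB : SemiprimeFAlgebra.IsIntermediate B) :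
    SemiprimeFAlgebra.IsOrderIdeal B.toSubmodule ∧
      ∃ (hsup : ∀ ⦃x y : A⦄, x ∈ B → y ∈ B → x ⊔ y ∈ B)
        (hinf : ∀ ⦃x y : A⦄, x ∈ B → y ∈ B → x ⊓ y ∈ B),
        letI : Lattice B := Subtype.lattice hsup hinf
        SemiprimeFAlgebra.IsFAlgebra B ∧ SemiprimeFAlgebra.IsSemiprime B ∧
          SemiprimeFAlgebra.IsDedekindComplete B := by
  have h := hB.isOrderIdeal hArch hSemi hDed
  have hsup : ∀ ⦃x y : A⦄, x ∈ B → y ∈ B → x ⊔ y ∈ B := fun _ _ hx hy =>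
    SemiprimeFAlgebra.sup_mem_of_isOrderIdeal h hx hy
  have hinf : ∀ ⦃x y : A⦄, x ∈ B → y ∈ B → x ⊓ y ∈ B := fun _ _ hx hy =>
    SemiprimeFAlgebra.inf_mem_of_isOrderIdeal h hx hy
  exact ⟨h, hsup, hinf, SemiprimeFAlgebra.isFAlgebra_subtype B hsup hinf, hSemi.subtype B,
    SemiprimeFAlgebra.isDedekindComplete_subtype hDed h hsup hinf⟩
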